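/- Let $\mathscr X$ be a Banach space, let $L:D(L)\subset\mathscr X\to\mathscr X$ be the generator of a strongly continuous semigroup on $\mathscr X$, let $N:\mathscr X\to\mathscr X$, and put $f(v)=Lv+N(v)$ for $v\in D(L)$. Let $t_0<T$ and let $u\in C^4([t_0,T];\mathscr X)$ be a solution of $u'(t)=f(u(t))$, $u(t_0)=u_0$, with $u(t)\in D(L)$ for all $t\in[t_0,T]$. Assume that $N$ is three times continuously Fréchet differentiable in a strip $\{v:\operatorname{dist}(v,u([t_0,T]))<\delta\}$, $\delta>0$. For $t_n\in[t_0,T]$ write $\tilde u_n=u(t_n)$, $\tilde u_n^{(j)}=u^{(j)}(t_n)$, $\tilde J_n=L+\frac{\partial N}{\partial u}(\tilde u_n)$ (with domain $D(L)$) and $\tilde N_n(v)=N(v)-\frac{\partial N}{\partial u}(\tilde u_n)v$. Then $\tilde J_n$ generates a strongly continuous semigroup $(e^{\tau\tilde J_n})_{\tau\ge0}$, and for $k\ge1$, $\tau\ge0$ we set $$\varphi_k(\tau\tilde J_n)x=\int_0^1 \frac{\theta^{k-1}}{(k-1)!}\,e^{(1-\theta)\tau\tilde J_n}x\,d\theta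 .$$ (i) For every $k\ge1$ and all $t\ge0$, $h\ge0$, $$\varphi_k(th\tilde J_n)f(\tilde u_n)=\frac1{k!}\tilde u_n'+h\frac{t}{(k+1)!}\tilde u_n''+t^2h^2\frac1{(k+2)!}\Big(\tilde u_n^{(3)}-(k+2)!\,\varphi_{k+2}(th\tilde J_n)\frac{\partial^2\tilde N_n}{\partial u^2}(\tilde u_n)(\tilde u_n',\tilde u_n')\Big)+\mathcal O(t^3h^3).$$ (ii) Let $s\in\mathbb N$, $p_{i1k}\in\mathbb R$ for $1\le k\le s$, and $\psi_{i1}(z)=\sum_{k=1}^s p_{i1k}\varphi_k(z)$. Then for all $t\ge0$ $$\psi_{i1}(t\tilde J_n)f(\tilde u_n)=\mathbb P_{i1}\tilde u_n'+t\,\mathbb P_{i2}\tilde u_n''+t^2\Big(\mathbb P_{i3}\tilde u_n^{(3)}-\sum_{k=1}^s p_{i1k}\varphi_{k+2}(t\tilde J_n)\frac{\partial^2\tilde N_n}{\partial u^2}(\tilde u_n)(\tilde u_n',\tilde u_n')\Big)+\mathcal O(t^3),$$ where $\mathbb P_{i1}=\sum_{k=1}^s\frac{p_{i1k}}{k!}$,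 $\mathbb P_{i2}=\sum_{k=1}^s\frac{p_{i1k}}{(k+1)!}$, $\mathbb P_{i3}=\sum_{k=1}^s\frac{p_{i1k}}{(k+2)!}$. Here the $\mathcal O$-terms are uniform on bounded ranges: for every $H$ there is a constant $C$, independent of $t_n\in[t_0,T]$, $t$ and $h$, such that the norm of the remainder in (i) is at most $Ct^3h^3$ whenever $th\le H$ (with $C$ depending on $k$), and the norm of the remainder in (ii) is at most $Ct^3$ whenever $t\le H$ (with $C$ depending on $s$ and the $p_{i1k}$). -/

import Mathlib

open Set Filter Topology MeasureTheory

namespace EPIRK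

variable {X : Type*} [NormedAddCommGroup X] [NormedSpace ℝ X]

/-- A strongly continuous one-parameter semigroup of bounded operators `S t`, `t ≥ 0`
(the values at negative times are irrelevant). -/
structure IsC0Semigroup (S : ℝ → X →L[ℝ] X) : Prop where
  map_zero : S 0 = ContinuousLinearMap.id ℝ X
  map_add : ∀ s t : ℝ, 0 ≤ s → 0 ≤ t → S (s + t) = (S s).comp (S t)
  continuousOn : ∀ x : X, ContinuousOn (fun t => S t x) (Ici 0)

/-- The (possibly unbounded) operator `A` is the infinitesimal generator of `S`: `x ∈ D(A)` and
`A x = y` if and only if `(S t x - x) / t → y` as `t ↓ 0`. -/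
def IsGeneratorOf (A : X →ₗ.[ℝ] X) (S : ℝ → X →L[ℝ] X) : Prop :=
  ∀ x y : X, (x, y) ∈ A.graph ↔
    Tendsto (fun t : ℝ => t⁻¹ • (S t x - x)) (𝓝[>] 0) (𝓝 y)

/-- `A` is the generator of a strongly continuous semigroup. -/
def GeneratesC0Semigroup (A : X →ₗ.[ℝ] X) : Prop :=
  ∃ S : ℝ → X →L[ℝ] X, IsC0Semigroup S ∧ IsGeneratorOf A S

open Classical in
/-- The semigroup `e^{tA}`, `t ≥ 0`, generated by `A`; its values for `t ≥ 0` are determined by `A`.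
(It is the zero family if `A` generates no strongly continuous semigroup.) -/
noncomputable def expSemigroup (A : X →ₗ.[ℝ] X) : ℝ → X →L[ℝ] X :=
  if h : GeneratesC0Semigroup A then h.choose else 0

/-- `φ_k(τ A) x = ∫₀¹ θ^{k-1}/(k-1)! • e^{(1-θ) τ A} x dθ`, for `k ≥ 1` and `τ ≥ 0`. -/
noncomputable def phi (k : ℕ) (τ : ℝ) (A : X →ₗ.[ℝ] X) (x : X) : X :=
  ∫ θ in (0 : ℝ)..1, (θ ^ (k - 1) / ((k - 1).factorial : ℝ)) • expSemigroup A ((1 - θ) * τ) x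

/-- `ψ(τ A) x = ∑_{k=1}^s p_k φ_k(τ A) x`. -/
noncomputable def psi (s : ℕ) (p : ℕ → ℝ) (τ : ℝ) (A : X →ₗ.[ℝ] X) (x : X) : X :=
  ∑ k ∈ Finset.Icc 1 s, p k • phi k τ A x

/-- `ℙ₁ = ∑_{k=1}^s p_k / k!`. -/
noncomputable def bigP1 (s : ℕ) (p : ℕ → ℝ) : ℝ :=
  ∑ k ∈ Finset.Icc 1 s, p k / (k.factorial : ℝ)

/-- `ℙ₂ = ∑_{k=1}^s p_k / (k+1)!`. -/
noncomputable def bigP2 (s : ℕ) (p : ℕ → ℝ) : ℝ :=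
  ∑ k ∈ Finset.Icc 1 s, p k / ((k + 1).factorial : ℝ)

/-- `ℙ₃ = ∑_{k=1}^s p_k / (k+2)!`. -/
noncomputable def bigP3 (s : ℕ) (p : ℕ → ℝ) : ℝ :=
  ∑ k ∈ Finset.Icc 1 s, p k / ((k + 2).factorial : ℝ)

/-- The right-hand side `f(v) = L v + N(v)`, defined for `v ∈ D(L)`. -/
def rhs (L : X →ₗ.[ℝ] X) (N : X → X) (v : L.domain) : X :=
  L v + N v

/-- The Jacobian `J(w) = L + N'(w)`, with domain `D(L)`. -/
noncomputable def jacobian (L : X →ₗ.[ℝ] X) (N : X → X) (w : X) : X →ₗ.[ℝ] X :=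
  (fderiv ℝ N w : X →ₗ[ℝ] X) +ᵥ L

/-- The nonlinearity `Ñ(v) = N(v) - N'(w) v` left after linearization at `w`. -/
noncomputable def remNonlin (N : X → X) (w v : X) : X :=
  N v - fderiv ℝ N w v

/-- On `D(L)` one has `Ñ(v) = f(v) - J(w) v`. -/
theorem remNonlin_eq (L : X →ₗ.[ℝ] X) (N : X → X) (w : X) (v : L.domain) :
    remNonlin N w v = rhs L N v - jacobian L N w v := by
  have h : jacobian L N w v = fderiv ℝ N w v + L v := rfl
  rw [h, rhs, remNonlin]
  abel

/-- `u : [t₀, T] → X` is a four times continuously differentiable solution of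
`u' = L u + N(u)`, `u(t₀) = u₀`, and `N` is three times continuously Fréchet differentiable in a
strip of some radius `δ > 0` around the trajectory of `u`. -/
structure SmoothSolution (L : X →ₗ.[ℝ] X) (N : X → X) (t₀ T : ℝ) (u₀ : X) (u : ℝ → X) :
    Prop where
  lt : t₀ < T
  init : u t₀ = u₀
  mem_domain : ∀ t ∈ Icc t₀ T, u t ∈ L.domain
  hasDeriv : ∀ t (ht : t ∈ Icc t₀ T),
    HasDerivWithinAt u (rhs L N ⟨u t, mem_domain t ht⟩) (Icc t₀ T) t
  contDiffOn : ContDiffOn ℝ 4 u (Icc t₀ T)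
  nonlin : ∃ δ > 0, ContDiffOn ℝ 3 N (Metric.thickening δ (u '' Icc t₀ T))

/-- The second Fréchet derivative term `Ñ''(u(τ))(u'(τ), u'(τ))`, with `Ñ` the nonlinearity left
after linearization at `u(τ)`; the derivative of `u` is taken within `[t₀, T]`. -/
noncomputable def secondTerm (N : X → X) (t₀ T : ℝ) (u : ℝ → X) (τ : ℝ) : X :=
  iteratedFDeriv ℝ 2 (remNonlin N (u τ)) (u τ)
    (fun _ => iteratedDerivWithin 1 u (Icc t₀ T) τ)

end EPIRK

/-! Write `J` for the Jacobian at `u(t_n)`. Differentiating `u' = L u + N(u)` shows that `f(u) = u'`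
starts a chain `J u' = u''`, `J u'' = u⁽³⁾ - Ñ''(u)(u', u')`, with `J u⁽³⁾` still a vector of `X`.
Integration by parts gives `φ_k(τJ)x = x/k! + τ φ_{k+1}(τJ)Jx` on `D(J)` (`phi_eq`). Used along the
chain, it yields the expansion exactly, with remainder `τ³ φ_{k+3}(τJ) J u⁽³⁾` (`phi_expansion`).
Part (ii) is a linear combination of instances of (i).

Two points need semigroup theory. The derivatives of `u` must lie in `D(L)`, although only `u(t) ∈
D(L)` is assumed: a generator is closed (`isClosed_graph`), so difference quotients in its graph
have their limit there (`derivative_mem_graph`, `mem_graph`).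

The remainder must also be bounded uniformly in `t_n`. The bounded perturbation theorem
(`exists_vadd`) gives growth constants depending only on a bound for the perturbation, and
`N'(u(t))` is bounded on the compact interval. Since `expSemigroup` is an arbitrary choice,
uniqueness (`eq_of_nonneg`) carries the bound over to it. -/

namespace EPIRK

variable {X : Type*} [NormedAddCommGroup X] [NormedSpace ℝ X]

/-! ### Strongly continuous semigroups: growth and joint continuity. -/

/-- If `F` is continuous, the mean value of `F t` over `[0, t]` tends to `F 0 0` as `t ↓ 0`. -/
theorem tendsto_inv_smul_integral [CompleteSpace X] {F : ℝ → ℝ → X} (hF : Continuous (Function.uncurry F)) :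
    Tendsto (fun t : ℝ => t⁻¹ • ∫ s in (0 : ℝ)..t, F t s) (𝓝[>] 0) (𝓝 (F 0 0)) := by
  -- The substitution `s = tθ` moves the mean to a fixed interval, where it is continuous in `t`
  -- even at `t = 0`.
  have hc : Continuous fun t : ℝ => ∫ θ in (0 : ℝ)..1, F t (t * θ) :=
    intervalIntegral.continuous_parametric_intervalIntegral_of_continuous'
      (f := fun t θ => F t (t * θ))
      (hF.comp (continuous_fst.prodMk (continuous_fst.mul continuous_snd))) 0 1
  have h0 : Tendsto (fun t : ℝ => ∫ θ in (0 : ℝ)..1, F t (t * θ)) (𝓝[>] 0) (𝓝 (F 0 0)) := by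
    simpa using (hc.tendsto 0).mono_left nhdsWithin_le_nhds
  refine h0.congr' ?_
  filter_upwards [self_mem_nhdsWithin] with t ht
  have ht' : t ≠ 0 := ne_of_gt ht
  rw [intervalIntegral.integral_comp_mul_left (fun s => F t s) ht']
  simp

namespace IsC0Semigroup

variable {S : ℝ → X →L[ℝ] X}

/-- Banach–Steinhaus bounds `S` by some `M ≥ 1` on `[0, 1]`. Each further unit of time costs a
factor `M`, so the rate is `log M`. -/
theorem exists_norm_le [CompleteSpace X] (hS : IsC0Semigroup S) :
    ∃ M ω : ℝ, 0 ≤ M ∧ 0 ≤ ω ∧ ∀ t, 0 ≤ t → ‖S t‖ ≤ M * Real.exp (ω * t) := by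
  obtain ⟨C, hC⟩ := banach_steinhaus (g := fun i : Icc (0 : ℝ) 1 => S i) (by
    intro x
    obtain ⟨C, hC⟩ := isCompact_Icc.exists_bound_of_continuousOn
      ((hS.continuousOn x).mono (Icc_subset_Ici_self : Icc (0 : ℝ) 1 ⊆ Ici 0))
    exact ⟨C, fun i => hC i i.2⟩)
  set M := max C 1 with hM
  have hM1 : 1 ≤ M := le_max_right _ _
  have hM0 : 0 < M := by linarith
  have hω : 0 ≤ Real.log M := Real.log_nonneg hM1
  have hloc : ∀ t, 0 ≤ t → t ≤ 1 → ‖S t‖ ≤ M := fun t h0 h1 =>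
    (hC ⟨t, h0, h1⟩).trans (le_max_left _ _)
  have key : ∀ n : ℕ, ∀ t : ℝ, 0 ≤ t → t ≤ n + 1 → ‖S t‖ ≤ M * Real.exp (Real.log M * t) := by
    intro n
    induction n with
    | zero =>
      intro t h0 h1
      have h2 : 1 ≤ Real.exp (Real.log M * t) := Real.one_le_exp (by positivity)
      have := hloc t h0 (by simpa using h1)
      nlinarith
    | succ n ih =>
      intro t h0 h1
      push_cast at h1
      rcases le_total t 1 with h | h
      · have h2 : 1 ≤ Real.exp (Real.log M * t) := Real.one_le_exp (by positivity)
        have := hloc t h0 h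
        nlinarith
      · have e : S t = (S 1).comp (S (t - 1)) := by
          rw [← hS.map_add 1 (t - 1) zero_le_one (by linarith)]
          congr 1
          ring
        calc ‖S t‖ ≤ ‖S 1‖ * ‖S (t - 1)‖ := e ▸ ContinuousLinearMap.opNorm_comp_le _ _
          _ ≤ M * (M * Real.exp (Real.log M * (t - 1))) :=
            mul_le_mul (hloc 1 zero_le_one le_rfl) (ih _ (by linarith) (by linarith))
              (norm_nonneg _) hM0.le
          _ = M * Real.exp (Real.log M * t) := by
            congr 1
            nth_rewrite 1 [← Real.exp_log hM0]
            rw [← Real.exp_add]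
            congr 1
            ring
  exact ⟨M, Real.log M, hM0.le, hω, fun t ht =>
    key ⌊t⌋₊ t ht (Nat.lt_floor_add_one t).le⟩

theorem map_add_apply (hS : IsC0Semigroup S) {s t : ℝ} (hs : 0 ≤ s) (ht : 0 ≤ t) (x : X) :
    S (s + t) x = S s (S t x) := by
  rw [hS.map_add s t hs ht]
  rfl

/-- Freezing the orbit at negative times makes it continuous on all of `ℝ`, so that it can be
integrated and composed without side conditions. -/
theorem continuous_max (hS : IsC0Semigroup S) (x : X) :
    Continuous fun t : ℝ => S (max t 0) x :=
  (hS.continuousOn x).comp_continuous (continuous_id.max continuous_const)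
    fun t => le_max_right t 0

theorem continuous_uncurry_max [CompleteSpace X] (hS : IsC0Semigroup S) :
    Continuous fun p : ℝ × X => S (max p.1 0) p.2 := by
  obtain ⟨M, ω, -, -, h⟩ := hS.exists_norm_le
  rw [continuous_iff_continuousAt]
  rintro ⟨t, x⟩
  have h1 : Tendsto (fun p : ℝ × X => S (max p.1 0) (p.2 - x)) (𝓝 (t, x)) (𝓝 0) := by
    refine squeeze_zero_norm (a := fun p : ℝ × X =>
      M * Real.exp (ω * max p.1 0) * ‖p.2 - x‖) (fun p =>
        (S _).le_of_opNorm_le (h _ (le_max_right _ _)) _) ?_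
    have hc : Continuous fun p : ℝ × X => M * Real.exp (ω * max p.1 0) * ‖p.2 - x‖ := by
      fun_prop
    simpa using hc.tendsto (t, x)
  have h2 : Tendsto (fun p : ℝ × X => S (max p.1 0) x) (𝓝 (t, x)) (𝓝 (S (max t 0) x)) :=
    ((hS.continuous_max x).comp continuous_fst).tendsto (t, x)
  simpa [ContinuousAt] using h1.add h2

theorem continuous_comp_max [CompleteSpace X] (hS : IsC0Semigroup S) {Y : Type*}
    [TopologicalSpace Y] {a : Y → ℝ} {b : Y → X} (ha : Continuous a) (hb : Continuous b) :
    Continuous fun y => S (max (a y) 0) (b y) :=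
  hS.continuous_uncurry_max.comp (ha.prodMk hb)

/-- The rescaled semigroup `e^{ct} S t`. -/
theorem exp_smul (hS : IsC0Semigroup S) (c : ℝ) :
    IsC0Semigroup fun t => Real.exp (c * t) • S t where
  map_zero := by simp [hS.map_zero]
  map_add s t hs ht := by
    ext x
    simp [hS.map_add_apply hs ht, mul_add, Real.exp_add, smul_smul, mul_comm]
  continuousOn x := by
    have : ContinuousOn (fun t : ℝ => Real.exp (c * t)) (Ici 0) := by fun_prop
    exact this.smul (hS.continuousOn x)

end IsC0Semigroup

/-! ### Generators: Newton–Leibniz formula, closedness, uniqueness of the semigroup. -/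

theorem IsGeneratorOf.map_mem_graph {A : X →ₗ.[ℝ] X} {S : ℝ → X →L[ℝ] X}
    (hA : IsGeneratorOf A S) (hS : IsC0Semigroup S) {x y : X} (h : (x, y) ∈ A.graph)
    {s : ℝ} (hs : 0 ≤ s) : (S s x, S s y) ∈ A.graph := by
  rw [hA]
  have h1 := ((S s).continuous.tendsto y).comp ((hA x y).1 h)
  refine h1.congr' ?_
  filter_upwards [self_mem_nhdsWithin] with t ht
  have ht' : 0 ≤ t := le_of_lt ht
  simp [← hS.map_add_apply hs ht', ← hS.map_add_apply ht' hs, add_comm]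

theorem hasDerivWithinAt_Ici_of_tendsto {g : ℝ → X} {y : X} {s : ℝ}
    (h : Tendsto (fun t : ℝ => t⁻¹ • (g (s + t) - g s)) (𝓝[>] 0) (𝓝 y)) :
    HasDerivWithinAt g y (Ici s) s := by
  rw [← hasDerivWithinAt_Ioi_iff_Ici, hasDerivWithinAt_iff_tendsto_slope' (by simp)]
  have h1 : Tendsto (fun r : ℝ => r - s) (𝓝[>] s) (𝓝[>] 0) := by
    refine tendsto_nhdsWithin_iff.2 ⟨?_, ?_⟩
    · have : Tendsto (fun r : ℝ => r - s) (𝓝 s) (𝓝 (s - s)) :=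
        (continuous_id.sub continuous_const).tendsto s
      rw [sub_self] at this
      exact this.mono_left nhdsWithin_le_nhds
    · filter_upwards [self_mem_nhdsWithin] with r hr
      exact mem_Ioi.2 (sub_pos.2 (mem_Ioi.1 hr))
  refine (h.comp h1).congr fun r => ?_
  simp [slope_def_module]

/-- The Newton–Leibniz formula for orbits that start in the domain of the generator. -/
theorem IsGeneratorOf.sub_eq_integral [CompleteSpace X] {A : X →ₗ.[ℝ] X} {S : ℝ → X →L[ℝ] X}
    (hA : IsGeneratorOf A S) (hS : IsC0Semigroup S) {x y : X} (h : (x, y) ∈ A.graph)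
    {t : ℝ} (ht : 0 ≤ t) : S t x - x = ∫ s in (0 : ℝ)..t, S (max s 0) y := by
  -- The definition of the generator provides right derivatives only; with continuity these suffice.
  have h1 := intervalIntegral.integral_eq_sub_of_hasDeriv_right_of_le ht
    (f := fun s => S (max s 0) x) (f' := fun s => S (max s 0) y)
    (hS.continuous_max x).continuousOn (fun s hs => by
      have hs0 : 0 ≤ s := hs.1.le
      refine HasDerivWithinAt.mono (t := Ici s) ?_ Ioi_subset_Ici_self
      refine hasDerivWithinAt_Ici_of_tendsto ?_
      rw [max_eq_left hs0]
      refine ((hA _ _).1 (hA.map_mem_graph hS h hs0)).congr' ?_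
      filter_upwards [self_mem_nhdsWithin] with r hr
      have hr0 : 0 ≤ r := le_of_lt hr
      rw [max_eq_left (add_nonneg hs0 hr0), add_comm s r, hS.map_add_apply hr0 hs0])
    ((hS.continuous_max y).intervalIntegrable _ _)
  rw [h1]
  simp [max_eq_left ht, hS.map_zero]

theorem IsGeneratorOf.mem_graph_of_sub_eq_integral [CompleteSpace X] {A : X →ₗ.[ℝ] X}
    {S : ℝ → X →L[ℝ] X} (hA : IsGeneratorOf A S) (hS : IsC0Semigroup S) {x y : X}
    (h : ∀ t, 0 ≤ t → S t x - x = ∫ s in (0 : ℝ)..t, S (max s 0) y) : (x, y) ∈ A.graph := by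
  rw [hA]
  have h1 := tendsto_inv_smul_integral (F := fun _ s => S (max s 0) y)
    ((hS.continuous_max y).comp continuous_snd)
  simp only [max_self, hS.map_zero, ContinuousLinearMap.id_apply] at h1
  refine h1.congr' ?_
  filter_upwards [self_mem_nhdsWithin] with t ht
  rw [h t (le_of_lt ht)]

/-- The generator of a strongly continuous semigroup is closed. -/
theorem IsGeneratorOf.isClosed_graph [CompleteSpace X] {A : X →ₗ.[ℝ] X} {S : ℝ → X →L[ℝ] X}
    (hA : IsGeneratorOf A S) (hS : IsC0Semigroup S) : IsClosed (A.graph : Set (X × X)) := by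
  -- The Newton–Leibniz identities characterize the graph, and each is a closed condition on `(x,
  -- y)`.
  have hset : (A.graph : Set (X × X)) =
      ⋂ t ∈ Ici (0 : ℝ), {p | S t p.1 - p.1 = ∫ s in (0 : ℝ)..t, S (max s 0) p.2} := by
    ext ⟨x, y⟩
    simp only [mem_iInter, SetLike.mem_coe]
    exact ⟨fun h t ht => hA.sub_eq_integral hS h ht,
      fun h => hA.mem_graph_of_sub_eq_integral hS h⟩
  rw [hset]
  refine isClosed_biInter fun t _ => isClosed_eq (by fun_prop) ?_
  exact intervalIntegral.continuous_parametric_intervalIntegral_of_continuous'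
    (f := fun (p : X × X) s => S (max s 0) p.2)
    (hS.continuous_comp_max continuous_snd (continuous_snd.comp continuous_fst)) 0 t

/-- Means of an orbit lie in the domain of the generator. -/
theorem IsGeneratorOf.integral_mem_graph [CompleteSpace X] {A : X →ₗ.[ℝ] X} {S : ℝ → X →L[ℝ] X}
    (hA : IsGeneratorOf A S) (hS : IsC0Semigroup S) (x : X) {ε : ℝ} (hε : 0 ≤ ε) :
    (∫ r in (0 : ℝ)..ε, S (max r 0) x, S ε x - x) ∈ A.graph := by
  have hc := hS.continuous_max x
  have hi : ∀ a b : ℝ, IntervalIntegrable (fun r => S (max r 0) x) volume a b :=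
    fun a b => hc.intervalIntegrable a b
  rw [hA]
  have h1 := tendsto_inv_smul_integral (F := fun _ s => S (max (ε + s) 0) x)
    (hc.comp (continuous_const.add continuous_snd))
  have h2 := tendsto_inv_smul_integral (F := fun _ s => S (max s 0) x)
    (hc.comp continuous_snd)
  have h3 := h1.sub h2
  simp only [add_zero, max_self, max_eq_left hε, hS.map_zero,
    ContinuousLinearMap.id_apply] at h3
  refine h3.congr' ?_
  filter_upwards [self_mem_nhdsWithin] with t ht
  have ht0 : 0 ≤ t := le_of_lt ht
  -- Applying `S t` shifts the window of integration by `t`; the overlap with `[0, ε]` cancels and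
  -- only means over the two end intervals remain.
  have e1 : S t (∫ r in (0 : ℝ)..ε, S (max r 0) x) = ∫ r in t..(ε + t), S (max r 0) x := by
    rw [← ContinuousLinearMap.intervalIntegral_comp_comm _ (hi 0 ε)]
    have e := intervalIntegral.integral_comp_add_left (a := 0) (b := ε)
      (fun r => S (max r 0) x) t
    rw [add_zero, add_comm t ε] at e
    rw [← e]
    refine intervalIntegral.integral_congr fun r hr => ?_
    rw [uIcc_of_le hε] at hr
    rw [max_eq_left hr.1, max_eq_left (add_nonneg ht0 hr.1), hS.map_add_apply ht0 hr.1]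
  have e2 : ∫ s in (0 : ℝ)..t, S (max (ε + s) 0) x = ∫ r in ε..(ε + t), S (max r 0) x := by
    rw [intervalIntegral.integral_comp_add_left (fun r => S (max r 0) x) ε, add_zero]
  rw [← smul_sub, e1, e2]
  congr 1
  rw [← intervalIntegral.integral_interval_sub_interval_comm (hi _ _) (hi _ _) (hi _ _)]
  rw [intervalIntegral.integral_symm 0 ε, intervalIntegral.integral_symm t (ε + t)]
  abel

/-- A strongly continuous semigroup is determined by its generator. -/
theorem IsGeneratorOf.eq_of_nonneg [CompleteSpace X] {A : X →ₗ.[ℝ] X} {S V : ℝ → X →L[ℝ] X}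
    (hA : IsGeneratorOf A S) (hS : IsC0Semigroup S) (hA' : IsGeneratorOf A V)
    (hV : IsC0Semigroup V) {t : ℝ} (ht : 0 ≤ t) : S t = V t := by
  have hdom : ∀ x y : X, (x, y) ∈ A.graph → S t x = V t x := by
    -- For `x` in the domain, `s ↦ V (t - s) (S s x)` is constant and joins `V t x` to `S t x`.
    intro x y hxy
    have hcont : Continuous fun s : ℝ => V (max (t - s) 0) (S (max s 0) x) :=
      hV.continuous_comp_max (by fun_prop) (hS.continuous_max x)
    have h := constant_of_has_deriv_right_zero (a := 0) (b := t) hcont.continuousOn (by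
      intro s hs
      have hm := hA.map_mem_graph hS hxy hs.1
      -- At `S s x` the quotients of `S` and `V` have the same limit. Their difference tends to
      -- zero, also after applying `V (t - (s + r))`, by joint continuity.
      have hz := ((hA _ _).1 hm).sub ((hA' _ _).1 hm)
      rw [sub_self] at hz
      have hc2 := (hV.continuous_uncurry_max.tendsto ((t - s), 0)).comp
        (((continuous_const.sub (continuous_const.add continuous_id) :
          Continuous fun r : ℝ => t - (s + r)).tendsto' 0 (t - s) (by simp)
            |>.mono_left nhdsWithin_le_nhds).prodMk_nhds hz)
      simp only [map_zero] at hc2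
      refine hasDerivWithinAt_Ici_of_tendsto (hc2.congr' ?_)
      have hlt : ∀ᶠ r : ℝ in 𝓝[>] 0, r < t - s :=
        nhdsWithin_le_nhds (eventually_lt_nhds (sub_pos.2 hs.2))
      filter_upwards [self_mem_nhdsWithin, hlt] with r hr hrt
      have hr0 : 0 ≤ r := le_of_lt hr
      have hs0 := hs.1
      have e1 : V (t - s) (S s x) = V (t - (s + r)) (V r (S s x)) := by
        rw [← hV.map_add_apply (by linarith) hr0]
        congr 2
        ring
      simp only [Function.comp_apply]
      rw [max_eq_left (by linarith : 0 ≤ t - (s + r)), max_eq_left (by linarith : 0 ≤ t - s),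
        max_eq_left hs0, max_eq_left (by linarith : 0 ≤ s + r), add_comm s r,
        hS.map_add_apply hr0 hs0, add_comm r s, e1, ← smul_sub, map_smul]
      simp [max_eq_left (by linarith : 0 ≤ t - (s + r))])
    have h1 := h t ⟨ht, le_rfl⟩
    simpa [max_eq_left ht, hS.map_zero, hV.map_zero] using h1
  -- Density of the domain: every `x` is the limit of means of its orbit.
  ext x
  have hlim := tendsto_inv_smul_integral (F := fun _ s => S (max s 0) x)
    ((hS.continuous_max x).comp continuous_snd)
  simp only [max_self, hS.map_zero, ContinuousLinearMap.id_apply] at hlim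
  refine tendsto_nhds_unique (((S t).continuous.tendsto x).comp hlim)
    ((((V t).continuous.tendsto x).comp hlim).congr' ?_)
  filter_upwards [self_mem_nhdsWithin] with ε hε
  simp only [Function.comp_apply, map_smul]
  rw [hdom _ _ (hA.integral_mem_graph hS x (le_of_lt hε))]

/-! ### Duhamel's equation for an exponentially stable semigroup. -/

open scoped BoundedContinuousFunction

/-- The bound does not depend on `τ`, which is why the Volterra operator acts on bounded functions
on an unbounded time interval. -/
theorem integral_exp_neg_mul_sub_le {μ τ : ℝ} (hμ : 0 < μ) :
    ∫ s in (0 : ℝ)..τ, Real.exp (-μ * (τ - s)) ≤ μ⁻¹ := by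
  have h : ∀ s ∈ uIcc 0 τ, HasDerivAt (fun s => μ⁻¹ * Real.exp (-μ * (τ - s)))
      (Real.exp (-μ * (τ - s))) s := by
    intro s _
    have h1 : HasDerivAt (fun s : ℝ => -μ * (τ - s)) μ s := by
      simpa using ((hasDerivAt_id s).const_sub τ).const_mul (-μ)
    have h2 := h1.exp.const_mul μ⁻¹
    rwa [mul_comm (Real.exp _) μ, inv_mul_cancel_left₀ hμ.ne'] at h2
  rw [intervalIntegral.integral_eq_sub_of_hasDerivAt h
    (Continuous.intervalIntegrable (by fun_prop) _ _)]
  have : 0 < μ⁻¹ * Real.exp (-μ * (τ - 0)) := by positivity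
  simp only [sub_self, mul_zero, Real.exp_zero, mul_one]
  linarith

section Volterra

variable {R : ℝ → X →L[ℝ] X} {M μ : ℝ}

theorem continuous_volterra_kernel [CompleteSpace X] (hR : IsC0Semigroup R) (B : X →L[ℝ] X) {v : ℝ → X}
    (hv : Continuous v) :
    Continuous (Function.uncurry fun τ s : ℝ => R (max (τ - s) 0) (B (v s))) :=
  hR.continuous_comp_max (continuous_fst.sub continuous_snd)
    (B.continuous.comp (hv.comp continuous_snd))

theorem norm_volterra_integral_le (hμ : 0 < μ) (hM : 0 ≤ M)
    (hb : ∀ t, 0 ≤ t → ‖R t‖ ≤ M * Real.exp (-μ * t)) (B : X →L[ℝ] X) (v : ℝ →ᵇ X)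
    {τ : ℝ} (hτ : 0 ≤ τ) :
    ‖∫ s in (0 : ℝ)..τ, R (max (τ - s) 0) (B (v s))‖ ≤ M * ‖B‖ * μ⁻¹ * ‖v‖ := by
  calc ‖∫ s in (0 : ℝ)..τ, R (max (τ - s) 0) (B (v s))‖
      ≤ ∫ s in (0 : ℝ)..τ, M * ‖B‖ * ‖v‖ * Real.exp (-μ * (τ - s)) := by
        refine intervalIntegral.norm_integral_le_of_norm_le hτ ?_
          (Continuous.intervalIntegrable (by fun_prop) _ _)
        refine ae_of_all _ fun s hs => ?_
        have hs' : 0 ≤ τ - s := sub_nonneg.2 hs.2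
        rw [max_eq_left hs']
        calc ‖R (τ - s) (B (v s))‖ ≤ (M * Real.exp (-μ * (τ - s))) * (‖B‖ * ‖v‖) := by
              refine (R _).le_of_opNorm_le_of_le (hb _ hs') ?_
              exact B.le_of_opNorm_le_of_le le_rfl (v.norm_coe_le_norm s)
          _ = _ := by ring
    _ ≤ M * ‖B‖ * ‖v‖ * μ⁻¹ := by
        rw [intervalIntegral.integral_const_mul]
        gcongr
        exact integral_exp_neg_mul_sub_le hμ
    _ = _ := by ring

/-- The Volterra operator `v ↦ ∫₀ᵗ R (t - s) (B (v s)) ds` on bounded continuous functions, for an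
exponentially stable semigroup `R`. -/
noncomputable def volterra [CompleteSpace X] (hR : IsC0Semigroup R) (hμ : 0 < μ) (hM : 0 ≤ M)
    (hb : ∀ t, 0 ≤ t → ‖R t‖ ≤ M * Real.exp (-μ * t)) (B : X →L[ℝ] X) :
    (ℝ →ᵇ X) →L[ℝ] (ℝ →ᵇ X) :=
  LinearMap.mkContinuous
    { toFun := fun v => BoundedContinuousFunction.ofNormedAddCommGroup
        (fun t => ∫ s in (0 : ℝ)..(max t 0), R (max (max t 0 - s) 0) (B (v s)))
        ((intervalIntegral.continuous_parametric_intervalIntegral_of_continuous (a₀ := 0)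
          (continuous_volterra_kernel hR B v.continuous) continuous_id).comp
            (continuous_id.max continuous_const))
        (M * ‖B‖ * μ⁻¹ * ‖v‖)
        (fun t => norm_volterra_integral_le hμ hM hb B v (le_max_right t 0))
      map_add' := fun v w => by
        ext t
        simp only [BoundedContinuousFunction.coe_ofNormedAddCommGroup,
          BoundedContinuousFunction.add_apply, map_add]
        exact intervalIntegral.integral_add
          (((continuous_volterra_kernel hR B v.continuous).comp
            (continuous_const.prodMk continuous_id)).intervalIntegrable _ _)
          (((continuous_volterra_kernel hR B w.continuous).comp
            (continuous_const.prodMk continuous_id)).intervalIntegrable _ _)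
      map_smul' := fun c v => by
        ext t
        simp [intervalIntegral.integral_smul] }
    (M * ‖B‖ * μ⁻¹)
    (fun v => BoundedContinuousFunction.norm_ofNormedAddCommGroup_le _ (by positivity)
      fun t => norm_volterra_integral_le hμ hM hb B v (le_max_right t 0))

theorem volterra_apply [CompleteSpace X] (hR : IsC0Semigroup R) (hμ : 0 < μ) (hM : 0 ≤ M)
    (hb : ∀ t, 0 ≤ t → ‖R t‖ ≤ M * Real.exp (-μ * t)) (B : X →L[ℝ] X) (v : ℝ →ᵇ X) (t : ℝ) :
    volterra hR hμ hM hb B v t =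
      ∫ s in (0 : ℝ)..(max t 0), R (max (max t 0 - s) 0) (B (v s)) :=
  rfl

theorem norm_volterra_le [CompleteSpace X] (hR : IsC0Semigroup R) (hμ : 0 < μ) (hM : 0 ≤ M)
    (hb : ∀ t, 0 ≤ t → ‖R t‖ ≤ M * Real.exp (-μ * t)) (B : X →L[ℝ] X) :
    ‖volterra hR hμ hM hb B‖ ≤ M * ‖B‖ * μ⁻¹ :=
  LinearMap.mkContinuous_norm_le _ (by positivity) _

theorem norm_max_apply_le (hμ : 0 < μ) (hM : 0 ≤ M)
    (hb : ∀ t, 0 ≤ t → ‖R t‖ ≤ M * Real.exp (-μ * t)) (x : X) (t : ℝ) :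
    ‖R (max t 0) x‖ ≤ M * ‖x‖ := by
  have h0 : 0 ≤ max t 0 := le_max_right _ _
  refine (R _).le_of_opNorm_le ((hb _ h0).trans ?_) x
  have : Real.exp (-μ * max t 0) ≤ 1 := Real.exp_le_one_iff.2 (by nlinarith)
  nlinarith

/-- The orbit map `x ↦ (t ↦ R t x)` of a bounded semigroup. -/
noncomputable def orbitMap (hR : IsC0Semigroup R) (hμ : 0 < μ) (hM : 0 ≤ M)
    (hb : ∀ t, 0 ≤ t → ‖R t‖ ≤ M * Real.exp (-μ * t)) : X →L[ℝ] (ℝ →ᵇ X) :=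
  LinearMap.mkContinuous
    { toFun := fun x => BoundedContinuousFunction.ofNormedAddCommGroup
        (fun t => R (max t 0) x) (hR.continuous_max x) (M * ‖x‖) (norm_max_apply_le hμ hM hb x)
      map_add' := fun x y => by ext t; simp
      map_smul' := fun c x => by ext t; simp }
    M
    (fun x => BoundedContinuousFunction.norm_ofNormedAddCommGroup_le _ (by positivity)
      (norm_max_apply_le hμ hM hb x))

theorem orbitMap_apply (hR : IsC0Semigroup R) (hμ : 0 < μ) (hM : 0 ≤ M)
    (hb : ∀ t, 0 ≤ t → ‖R t‖ ≤ M * Real.exp (-μ * t)) (x : X) (t : ℝ) :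
    orbitMap hR hμ hM hb x t = R (max t 0) x :=
  rfl

theorem norm_orbitMap_le (hR : IsC0Semigroup R) (hμ : 0 < μ) (hM : 0 ≤ M)
    (hb : ∀ t, 0 ≤ t → ‖R t‖ ≤ M * Real.exp (-μ * t)) : ‖orbitMap hR hμ hM hb‖ ≤ M :=
  LinearMap.mkContinuous_norm_le _ hM _

/-- For an exponentially stable semigroup `R` and a sufficiently small bounded operator `B`, the
Duhamel equation `V t x = R t x + ∫₀ᵗ R (t - s) (B (V s x)) ds` is solved by a bounded strongly
continuous semigroup. -/
theorem exists_duhamel_of_stable [CompleteSpace X] (hR : IsC0Semigroup R) (hμ : 0 < μ) (hM : 0 ≤ M)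
    (hb : ∀ t, 0 ≤ t → ‖R t‖ ≤ M * Real.exp (-μ * t)) (B : X →L[ℝ] X)
    (hB : M * ‖B‖ * μ⁻¹ ≤ 1 / 2) :
    ∃ V : ℝ → X →L[ℝ] X, IsC0Semigroup V ∧ (∀ t, ‖V t‖ ≤ 2 * M) ∧
      ∀ t, 0 ≤ t → ∀ x,
        V t x = R t x + ∫ s in (0 : ℝ)..t, R (max (t - s) 0) (B (V s x)) := by
  set K := volterra hR hμ hM hb B with hK
  have hK1 : ‖K‖ ≤ 1 / 2 := (norm_volterra_le hR hμ hM hb B).trans hB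
  have hKlt : ‖K‖ < 1 := by linarith
  -- The Duhamel equation reads `(1 - K) v = orbit of x`; a Neumann series inverts `1 - K`, and the
  -- solution `G x` depends linearly and continuously on `x`.
  set U := Units.oneSub K hKlt with hU
  set G : X →L[ℝ] (ℝ →ᵇ X) := (↑U⁻¹ : (ℝ →ᵇ X) →L[ℝ] (ℝ →ᵇ X)).comp
    (orbitMap hR hμ hM hb) with hG
  have hsol : ∀ x, G x = orbitMap hR hμ hM hb x + K (G x) := by
    intro x
    have h1 : (↑U : (ℝ →ᵇ X) →L[ℝ] (ℝ →ᵇ X)) (G x) = orbitMap hR hμ hM hb x := by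
      change ((↑U * ↑U⁻¹ : (ℝ →ᵇ X) →L[ℝ] (ℝ →ᵇ X))) (orbitMap hR hμ hM hb x) = _
      rw [Units.mul_inv]
      rfl
    have h2 : (↑U : (ℝ →ᵇ X) →L[ℝ] (ℝ →ᵇ X)) (G x) = G x - K (G x) := rfl
    rw [← h1, h2]
    abel
  have huniq : ∀ (v : ℝ →ᵇ X) x, v = orbitMap hR hμ hM hb x + K v → v = G x := by
    intro v x hv
    have h2 : (↑U : (ℝ →ᵇ X) →L[ℝ] (ℝ →ᵇ X)) v = orbitMap hR hμ hM hb x :=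
      sub_eq_of_eq_add hv
    change v = (↑U⁻¹ : (ℝ →ᵇ X) →L[ℝ] (ℝ →ᵇ X)) (orbitMap hR hμ hM hb x)
    rw [← h2]
    change v = ((↑U⁻¹ * ↑U : (ℝ →ᵇ X) →L[ℝ] (ℝ →ᵇ X))) v
    rw [Units.inv_mul]
    rfl
  have hduh : ∀ t, 0 ≤ t → ∀ x,
      G x t = R t x + ∫ s in (0 : ℝ)..t, R (max (t - s) 0) (B (G x s)) := by
    intro t ht x
    have h1 := DFunLike.congr_fun (hsol x) t
    rwa [BoundedContinuousFunction.add_apply, orbitMap_apply, volterra_apply,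
      max_eq_left ht] at h1
  have hker : ∀ x τ a b, IntervalIntegrable (fun s => R (max (τ - s) 0) (B (G x s)))
      volume a b := fun x τ a b =>
    ((continuous_volterra_kernel hR B (G x).continuous).comp
      (continuous_const.prodMk continuous_id)).intervalIntegrable _ _
  refine ⟨fun t => (BoundedContinuousFunction.evalCLM ℝ t).comp G, ⟨?_, ?_, ?_⟩, ?_, hduh⟩
  · ext x
    have := hduh 0 le_rfl x
    simpa [hR.map_zero] using this
  · intro r a hr ha
    ext x
    change G x (r + a) = G (G x a) r
    -- The semigroup law follows from uniqueness: the orbit translated by `a` solves the Duhamel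
    -- equation with initial value `G x a`. To see this, the integral over `[0, r + a]` is split at
    -- `a`.
    let v : ℝ →ᵇ X := (G x).compContinuous
      ⟨fun r => max r 0 + a, by fun_prop⟩
    have hv : ∀ r, v r = G x (max r 0 + a) := fun _ => rfl
    have h1 : v = G (G x a) := by
      refine huniq v _ ?_
      ext r
      have hρ : 0 ≤ max r 0 := le_max_right _ _
      rw [BoundedContinuousFunction.add_apply, orbitMap_apply, hK, volterra_apply, hv]
      generalize max r 0 = ρ at hρ
      rw [hduh _ (add_nonneg hρ ha), hduh a ha, map_add, ← hR.map_add_apply hρ ha, add_assoc]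
      congr 1
      rw [← intervalIntegral.integral_add_adjacent_intervals (hker x _ 0 a) (hker x _ a (ρ + a))]
      congr 1
      · rw [← ContinuousLinearMap.intervalIntegral_comp_comm _ (hker x a 0 a)]
        refine intervalIntegral.integral_congr fun s hs => ?_
        rw [uIcc_of_le ha] at hs
        have hs' : 0 ≤ a - s := sub_nonneg.2 hs.2
        rw [max_eq_left hs', max_eq_left (by linarith), ← hR.map_add_apply hρ hs']
        congr 2
        ring
      · have e := intervalIntegral.integral_comp_add_right (a := 0) (b := ρ)
          (fun s => R (max (ρ + a - s) 0) (B (G x s))) a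
        rw [zero_add] at e
        rw [← e]
        refine intervalIntegral.integral_congr fun s hs => ?_
        rw [uIcc_of_le hρ] at hs
        rw [hv, max_eq_left hs.1, add_sub_add_right_eq_sub]
    rw [← h1, hv, max_eq_left hr]
  · intro x
    exact (G x).continuous.continuousOn
  · intro t
    refine ContinuousLinearMap.opNorm_le_bound _ (by positivity) fun x => ?_
    change ‖G x t‖ ≤ _
    -- Absorbing the last term on the left gives the constant `2 * M`.
    have h1 : ‖G x‖ ≤ M * ‖x‖ + 1 / 2 * ‖G x‖ := by
      nth_rewrite 1 [hsol x]
      refine (norm_add_le _ _).trans (add_le_add ?_ ?_)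
      · exact (orbitMap hR hμ hM hb).le_of_opNorm_le (norm_orbitMap_le hR hμ hM hb) x
      · exact K.le_of_opNorm_le hK1 _
    have h2 := (G x).norm_coe_le_norm t
    linarith

end Volterra

/-! ### Bounded perturbation of generators. -/

theorem mem_graph_vadd_iff (A : X →ₗ.[ℝ] X) (B : X →L[ℝ] X) (x y : X) :
    (x, y) ∈ ((B : X →ₗ[ℝ] X) +ᵥ A).graph ↔ (x, y - B x) ∈ A.graph := by
  rw [LinearPMap.mem_graph_iff, LinearPMap.mem_graph_iff]
  constructor
  · rintro ⟨z, hz, h⟩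
    refine ⟨z, hz, ?_⟩
    simp only at hz h ⊢
    rw [← h, ← hz]
    change A z = (B z + A z) - B z
    abel
  · rintro ⟨z, hz, h⟩
    refine ⟨z, hz, ?_⟩
    simp only at hz h ⊢
    change B z + A z = y
    rw [h, ← hz]
    abel

/-- A semigroup that solves the Duhamel equation is generated by the perturbed generator. -/
theorem IsGeneratorOf.vadd_of_duhamel [CompleteSpace X] {A : X →ₗ.[ℝ] X} {S V : ℝ → X →L[ℝ] X}
    (hA : IsGeneratorOf A S) (hS : IsC0Semigroup S) (hV : IsC0Semigroup V) (B : X →L[ℝ] X)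
    (h : ∀ t, 0 ≤ t → ∀ x,
      V t x = S t x + ∫ s in (0 : ℝ)..t, S (max (t - s) 0) (B (V s x))) :
    IsGeneratorOf ((B : X →ₗ[ℝ] X) +ᵥ A) V := by
  intro x y
  rw [mem_graph_vadd_iff, hA]
  have h1 := tendsto_inv_smul_integral
    (continuous_volterra_kernel hS B (hV.continuous_max x))
  simp only [sub_self, max_self, hS.map_zero, hV.map_zero, ContinuousLinearMap.id_apply] at h1
  -- The quotients of `V` and `S` differ by a mean that tends to `B x`, so one converges exactly
  -- when the other does.
  have h2 : ∀ t ∈ Ioi (0 : ℝ), t⁻¹ • (V t x - x) = t⁻¹ • (S t x - x) +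
      t⁻¹ • ∫ s in (0 : ℝ)..t, S (max (t - s) 0) (B (V (max s 0) x)) := by
    intro t ht
    rw [← smul_add, h t (le_of_lt ht) x]
    congr 1
    rw [add_sub_right_comm]
    congr 1
    refine intervalIntegral.integral_congr fun s hs => ?_
    rw [uIcc_of_le (le_of_lt ht)] at hs
    rw [max_eq_left hs.1]
  constructor
  · intro h3
    have h4 := h3.add h1
    rw [sub_add_cancel] at h4
    refine h4.congr' ?_
    filter_upwards [self_mem_nhdsWithin] with t ht
    exact (h2 t ht).symm
  · intro h3
    refine (h3.sub h1).congr' ?_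
    filter_upwards [self_mem_nhdsWithin] with t ht
    rw [h2 t ht, add_sub_cancel_right]

/-- Bounded perturbation of a generator, with a growth bound that depends only on the size of the
perturbation. -/
theorem IsGeneratorOf.exists_vadd [CompleteSpace X] {A : X →ₗ.[ℝ] X} {S : ℝ → X →L[ℝ] X}
    (hA : IsGeneratorOf A S) (hS : IsC0Semigroup S) (β : ℝ) :
    ∃ C ω : ℝ, 0 ≤ C ∧ 0 ≤ ω ∧ ∀ B : X →L[ℝ] X, ‖B‖ ≤ β → ∃ V : ℝ → X →L[ℝ] X,
      IsC0Semigroup V ∧ IsGeneratorOf ((B : X →ₗ[ℝ] X) +ᵥ A) V ∧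
        ∀ t, 0 ≤ t → ‖V t‖ ≤ C * Real.exp (ω * t) := by
  obtain ⟨M, ω, hM, hω, hb⟩ := hS.exists_norm_le
  -- Rescaling by `e^{-(ω + μ)t}` leaves decay rate `μ`, and this `μ` makes the Volterra norm `M ‖B‖
  -- / μ` at most `1/2` for every admissible `B`. The constants therefore depend on `β` but not on
  -- `B`.
  set μ : ℝ := 2 * M * |β| + 1 with hμdef
  have hμ : 0 < μ := by positivity
  set l : ℝ := ω + μ with hl
  refine ⟨2 * M, l, by positivity, by positivity, fun B hB => ?_⟩
  have hR := hS.exp_smul (-l)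
  obtain ⟨W, hW, hWb, hWd⟩ := exists_duhamel_of_stable hR hμ hM (by
    intro t ht
    rw [norm_smul, Real.norm_eq_abs, Real.abs_exp]
    calc Real.exp (-l * t) * ‖S t‖ ≤ Real.exp (-l * t) * (M * Real.exp (ω * t)) := by
          gcongr
          exact hb t ht
      _ = M * (Real.exp (-l * t) * Real.exp (ω * t)) := by ring
      _ = M * Real.exp (-μ * t) := by
          rw [← Real.exp_add]
          congr 2
          rw [hl]
          ring) B (by
    rw [mul_inv_le_iff₀ hμ]
    have : M * ‖B‖ ≤ M * |β| := by
      gcongr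
      exact hB.trans (le_abs_self β)
    linarith)
  have hV := hW.exp_smul l
  refine ⟨_, hV, hA.vadd_of_duhamel hS hV B ?_, ?_⟩
  · intro t ht x
    simp only [smul_apply]
    -- Undoing the rescaling: `e^{lt}` cancels the factor of `R t`, and under the integral `e^{lt}
    -- e^{-l(t-s)} = e^{ls}` is the factor of `V s`.
    rw [hWd t ht x, smul_add, ← intervalIntegral.integral_smul]
    congr 1
    · simp [smul_smul, ← Real.exp_add]
    · refine intervalIntegral.integral_congr fun s hs => ?_
      rw [uIcc_of_le ht] at hs
      have hs' : 0 ≤ t - s := sub_nonneg.2 hs.2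
      simp only [max_eq_left hs', smul_apply, map_smul, smul_smul,
        ← Real.exp_add]
      congr 2
      ring
  · intro t ht
    rw [norm_smul, Real.norm_eq_abs, Real.abs_exp, mul_comm]
    gcongr
    exact hWb t

/-! ### The `φ`-functions: recursion, bound and expansion. -/

theorem GeneratesC0Semigroup.expSemigroup_spec {A : X →ₗ.[ℝ] X} (hA : GeneratesC0Semigroup A) :
    IsC0Semigroup (expSemigroup A) ∧ IsGeneratorOf A (expSemigroup A) := by
  rw [expSemigroup, dif_pos hA]
  exact hA.choose_spec

/-- Recursion of the `φ`-functions: `φ_k(τA) x = x / k! + τ φ_{k+1}(τA) A x` for `x ∈ D(A)`. -/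
theorem GeneratesC0Semigroup.phi_eq [CompleteSpace X] {A : X →ₗ.[ℝ] X}
    (hA : GeneratesC0Semigroup A) {x y : X} (hxy : (x, y) ∈ A.graph) {k : ℕ} (hk : 1 ≤ k)
    {τ : ℝ} (hτ : 0 ≤ τ) :
    phi k τ A x = (1 / (k.factorial : ℝ)) • x + τ • phi (k + 1) τ A y := by
  obtain ⟨hS, hG⟩ := hA.expSemigroup_spec
  set S := expSemigroup A with hSdef
  obtain ⟨m, rfl⟩ : ∃ m, k = m + 1 := ⟨k - 1, by omega⟩
  have hcy := hS.continuous_max y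
  -- This primitive agrees with the orbit for `r ≥ 0` and is differentiable on all of `ℝ`, so the
  -- integration by parts has no one-sided derivative at `θ = 1`.
  set g : ℝ → X := fun r => x + ∫ s in (0 : ℝ)..r, S (max s 0) y with hg
  have hgd : ∀ r, HasDerivAt g (S (max r 0) y) r := fun r =>
    (intervalIntegral.integral_hasDerivAt_right (hcy.intervalIntegrable _ _)
      (hcy.stronglyMeasurableAtFilter _ _) hcy.continuousAt).const_add x
  have hgc : Continuous g := continuous_iff_continuousAt.2 fun r => (hgd r).continuousAt
  have hgS : ∀ r, 0 ≤ r → S r x = g r := fun r hr => by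
    have := hG.sub_eq_integral hS hxy hr
    simp only [hg, ← this]
    abel
  have hd : ∀ θ ∈ uIcc (0 : ℝ) 1, HasDerivAt
      (fun θ : ℝ => (θ ^ (m + 1) / ((m + 1).factorial : ℝ)) • g ((1 - θ) * τ))
      ((θ ^ m / (m.factorial : ℝ)) • g ((1 - θ) * τ)
        - τ • (θ ^ (m + 1) / ((m + 1).factorial : ℝ)) • S (max ((1 - θ) * τ) 0) y) θ := by
    intro θ _
    have h1 : HasDerivAt (fun θ : ℝ => (1 - θ) * τ) (-τ) θ := by
      simpa using ((hasDerivAt_id θ).const_sub 1).mul_const τ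
    have h2 := (hgd ((1 - θ) * τ)).scomp θ h1
    have h3 : HasDerivAt (fun θ : ℝ => θ ^ (m + 1) / ((m + 1).factorial : ℝ))
        (θ ^ m / (m.factorial : ℝ)) θ := by
      refine ((hasDerivAt_pow (m + 1) θ).div_const ((m + 1).factorial : ℝ)).congr_deriv ?_
      rw [Nat.factorial_succ]
      push_cast
      have : (m.factorial : ℝ) ≠ 0 := by positivity
      have : (m : ℝ) + 1 ≠ 0 := by positivity
      field_simp
    refine (h3.smul h2).congr_deriv ?_
    simp only [Function.comp_apply, neg_smul, smul_neg]
    rw [smul_comm τ]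
    abel
  have hi1 : IntervalIntegrable (fun θ : ℝ => (θ ^ m / (m.factorial : ℝ)) • g ((1 - θ) * τ))
      volume 0 1 :=
    Continuous.intervalIntegrable (by fun_prop) _ _
  have hi2 : IntervalIntegrable (fun θ : ℝ => τ • (θ ^ (m + 1) / ((m + 1).factorial : ℝ)) •
      S (max ((1 - θ) * τ) 0) y) volume 0 1 := by
    have : Continuous fun θ : ℝ => S (max ((1 - θ) * τ) 0) y :=
      hcy.comp (by fun_prop : Continuous fun θ : ℝ => (1 - θ) * τ)
    exact (((by fun_prop : Continuous fun θ : ℝ => θ ^ (m + 1) / ((m + 1).factorial : ℝ)).smul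
      this).const_smul τ).intervalIntegrable _ _
  have hint := intervalIntegral.integral_eq_sub_of_hasDerivAt hd (hi1.sub hi2)
  rw [intervalIntegral.integral_sub hi1 hi2, intervalIntegral.integral_smul] at hint
  have hpos : ∀ θ ∈ uIcc (0 : ℝ) 1, 0 ≤ (1 - θ) * τ := fun θ hθ => by
    rw [uIcc_of_le zero_le_one] at hθ
    exact mul_nonneg (sub_nonneg.2 hθ.2) hτ
  have e1 : phi (m + 1) τ A x =
      ∫ θ in (0 : ℝ)..1, (θ ^ m / (m.factorial : ℝ)) • g ((1 - θ) * τ) := by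
    refine intervalIntegral.integral_congr fun θ hθ => ?_
    simp only [Nat.add_sub_cancel]
    rw [← hSdef, hgS _ (hpos θ hθ)]
  have e2 : phi (m + 1 + 1) τ A y = ∫ θ in (0 : ℝ)..1,
      (θ ^ (m + 1) / ((m + 1).factorial : ℝ)) • S (max ((1 - θ) * τ) 0) y := by
    refine intervalIntegral.integral_congr fun θ hθ => ?_
    simp only [Nat.add_sub_cancel]
    rw [← hSdef, max_eq_left (hpos θ hθ)]
  rw [e1, e2, ← sub_eq_iff_eq_add, hint]
  -- The boundary term vanishes at `θ = 0`, because the power is `m + 1`, and equals `x / (m + 1)!`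
  -- at `θ = 1`.
  simp [hg]

theorem norm_phi_le {A : X →ₗ.[ℝ] X} {τ C : ℝ} (hτ : 0 ≤ τ)
    (h : ∀ r ∈ Icc 0 τ, ‖expSemigroup A r‖ ≤ C) (k : ℕ) (x : X) :
    ‖phi k τ A x‖ ≤ C * ‖x‖ := by
  have h1 := intervalIntegral.norm_integral_le_of_norm_le_const (a := 0) (b := 1)
    (C := C * ‖x‖)
    (f := fun θ : ℝ => (θ ^ (k - 1) / ((k - 1).factorial : ℝ)) •
      expSemigroup A ((1 - θ) * τ) x) (by
      intro θ hθ
      rw [uIoc_of_le zero_le_one] at hθ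
      have hθ0 := hθ.1.le
      have hθ1 := hθ.2
      have hf : (1 : ℝ) ≤ ((k - 1).factorial : ℝ) := by
        exact_mod_cast Nat.one_le_iff_ne_zero.2 (Nat.factorial_ne_zero _)
      have hle : θ ^ (k - 1) / ((k - 1).factorial : ℝ) ≤ 1 :=
        div_le_one_of_le₀ ((pow_le_one₀ hθ0 hθ1).trans hf) (by positivity)
      have hn : ‖expSemigroup A ((1 - θ) * τ) x‖ ≤ C * ‖x‖ := by
        refine ContinuousLinearMap.le_of_opNorm_le _ (h _ ⟨?_, ?_⟩) x
        · exact mul_nonneg (by linarith) hτ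
        · nlinarith
      rw [norm_smul, Real.norm_of_nonneg (by positivity)]
      exact (mul_le_of_le_one_left (norm_nonneg _) hle).trans hn)
  simpa [phi] using h1

/-- Third order expansion of `φ_k(τA) x₁` along a chain `A x₁ = x₂`, `A x₂ = x₃ - g`,
`A x₃ = z`. -/
theorem GeneratesC0Semigroup.phi_expansion [CompleteSpace X] {A : X →ₗ.[ℝ] X}
    (hA : GeneratesC0Semigroup A) {x₁ x₂ x₃ g z : X} (h₁ : (x₁, x₂) ∈ A.graph)
    (h₂ : (x₂, x₃ - g) ∈ A.graph) (h₃ : (x₃, z) ∈ A.graph) {k : ℕ} (hk : 1 ≤ k)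
    {τ : ℝ} (hτ : 0 ≤ τ) :
    phi k τ A x₁ = (1 / (k.factorial : ℝ)) • x₁ + (τ / ((k + 1).factorial : ℝ)) • x₂
      + τ ^ 2 • ((1 / ((k + 2).factorial : ℝ)) • x₃ - phi (k + 2) τ A g)
      + τ ^ 3 • phi (k + 3) τ A z := by
  have hc : ∀ x, Continuous fun θ : ℝ => (θ ^ (k + 2 - 1) / ((k + 2 - 1).factorial : ℝ)) •
      expSemigroup A (max ((1 - θ) * τ) 0) x := fun x => by
    have : Continuous fun θ : ℝ => expSemigroup A (max ((1 - θ) * τ) 0) x :=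
      (hA.expSemigroup_spec.1.continuous_max x).comp
        (by fun_prop : Continuous fun θ : ℝ => (1 - θ) * τ)
    fun_prop
  have e : ∀ x, phi (k + 2) τ A x = ∫ θ in (0 : ℝ)..1,
      (θ ^ (k + 2 - 1) / ((k + 2 - 1).factorial : ℝ)) •
        expSemigroup A (max ((1 - θ) * τ) 0) x := fun x => by
    refine intervalIntegral.integral_congr fun θ hθ => ?_
    rw [uIcc_of_le zero_le_one] at hθ
    rw [max_eq_left (mul_nonneg (sub_nonneg.2 hθ.2) hτ)]
  -- The vector `g` need not lie in `D(A)`, so its term is split off before the third use of the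
  -- recursion and kept whole.
  have hsub : phi (k + 2) τ A (x₃ - g) = phi (k + 2) τ A x₃ - phi (k + 2) τ A g := by
    rw [e, e, e, ← intervalIntegral.integral_sub ((hc _).intervalIntegrable _ _)
      ((hc _).intervalIntegrable _ _)]
    simp only [map_sub, smul_sub]
  rw [hA.phi_eq h₁ hk hτ, hA.phi_eq h₂ (by omega) hτ, hsub, hA.phi_eq h₃ (by omega) hτ]
  module

/-! ### Derivatives of the solution and the chain for the Jacobian. -/

theorem hasDerivWithinAt_iteratedDerivWithin {v : ℝ → X} {I : Set ℝ} {n : WithTop ℕ∞} {j : ℕ}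
    (hv : ContDiffOn ℝ n v I) (hI : UniqueDiffOn ℝ I) (hj : (j : WithTop ℕ∞) < n) {t : ℝ}
    (ht : t ∈ I) :
    HasDerivWithinAt (iteratedDerivWithin j v I) (iteratedDerivWithin (j + 1) v I t) I t := by
  rw [iteratedDerivWithin_succ]
  exact (hv.differentiableOn_iteratedDerivWithin hj hI t ht).hasDerivWithinAt

/-- Derivatives of curves in a closed operator stay in its graph. -/
theorem derivative_mem_graph {A : X →ₗ.[ℝ] X} (hA : IsClosed (A.graph : Set (X × X)))
    {I : Set ℝ} (hI : UniqueDiffOn ℝ I) {v w : ℝ → X} (h : ∀ t ∈ I, (v t, w t) ∈ A.graph)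
    {t : ℝ} (ht : t ∈ I) {v' w' : X} (hv : HasDerivWithinAt v v' I t)
    (hw : HasDerivWithinAt w w' I t) : (v', w') ∈ A.graph := by
  have hp := hasDerivWithinAt_iff_tendsto_slope.1 (hv.prodMk hw)
  have hne : (𝓝[I \ {t}] t).NeBot := by
    have := (hI t ht).accPt
    rwa [accPt_principal_iff_nhdsWithin] at this
  -- Slopes of the curve `(v, w)` lie in the graph because it is a linear subspace.
  refine hA.mem_of_tendsto hp ?_
  filter_upwards [self_mem_nhdsWithin] with s hs
  exact A.graph.smul_mem _ (A.graph.sub_mem (h s hs.1) (h t ht))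

namespace SmoothSolution

variable {L : X →ₗ.[ℝ] X} {N : X → X} {t₀ T : ℝ} {u₀ : X} {u : ℝ → X}

theorem contDiffAt_nonlin (hu : SmoothSolution L N t₀ T u₀ u) {t : ℝ} (ht : t ∈ Icc t₀ T) :
    ContDiffAt ℝ 3 N (u t) := by
  obtain ⟨δ, hδ, hN⟩ := hu.nonlin
  exact hN.contDiffAt (Metric.isOpen_thickening.mem_nhds
    (Metric.self_subset_thickening hδ _ (mem_image_of_mem u ht)))

theorem contDiffOn_comp (hu : SmoothSolution L N t₀ T u₀ u) :
    ContDiffOn ℝ 3 (N ∘ u) (Icc t₀ T) := fun t ht =>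
  (hu.contDiffAt_nonlin ht).comp_contDiffWithinAt t
    ((hu.contDiffOn t ht).of_le (by norm_num))

theorem hasDerivWithinAt (hu : SmoothSolution L N t₀ T u₀ u) {j : ℕ} (hj : j < 4) {t : ℝ}
    (ht : t ∈ Icc t₀ T) :
    HasDerivWithinAt (iteratedDerivWithin j u (Icc t₀ T))
      (iteratedDerivWithin (j + 1) u (Icc t₀ T) t) (Icc t₀ T) t :=
  hasDerivWithinAt_iteratedDerivWithin hu.contDiffOn (uniqueDiffOn_Icc hu.lt)
    (by exact_mod_cast hj) ht

theorem iteratedDerivWithin_one_eq (hu : SmoothSolution L N t₀ T u₀ u) {t : ℝ}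
    (ht : t ∈ Icc t₀ T) :
    iteratedDerivWithin 1 u (Icc t₀ T) t = rhs L N ⟨u t, hu.mem_domain t ht⟩ := by
  rw [iteratedDerivWithin_one]
  exact (hu.hasDeriv t ht).derivWithin (uniqueDiffOn_Icc hu.lt t ht)

/-- The derivatives of the solution satisfy the differentiated equation
`u⁽ʲ⁺¹⁾ = L u⁽ʲ⁾ + (N ∘ u)⁽ʲ⁾`. -/
theorem mem_graph (hu : SmoothSolution L N t₀ T u₀ u)
    (hL : IsClosed (L.graph : Set (X × X))) {j : ℕ} (hj : j ≤ 3) :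
    ∀ t ∈ Icc t₀ T, (iteratedDerivWithin j u (Icc t₀ T) t,
      iteratedDerivWithin (j + 1) u (Icc t₀ T) t
        - iteratedDerivWithin j (N ∘ u) (Icc t₀ T) t) ∈ L.graph := by
  induction j with
  | zero =>
    intro t ht
    rw [zero_add, hu.iteratedDerivWithin_one_eq ht, rhs]
    simp only [iteratedDerivWithin_zero, Function.comp_apply, add_sub_cancel_right]
    exact L.mem_graph ⟨u t, hu.mem_domain t ht⟩
  | succ j ih =>
    intro t ht
    exact derivative_mem_graph hL (uniqueDiffOn_Icc hu.lt) (ih (by omega)) ht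
      (hu.hasDerivWithinAt (by omega) ht)
      ((hu.hasDerivWithinAt (by omega) ht).sub
        (hasDerivWithinAt_iteratedDerivWithin hu.contDiffOn_comp (uniqueDiffOn_Icc hu.lt)
          (by exact_mod_cast hj) ht))

theorem iteratedDerivWithin_one_comp (hu : SmoothSolution L N t₀ T u₀ u) {t : ℝ}
    (ht : t ∈ Icc t₀ T) :
    iteratedDerivWithin 1 (N ∘ u) (Icc t₀ T) t =
      fderiv ℝ N (u t) (iteratedDerivWithin 1 u (Icc t₀ T) t) := by
  rw [iteratedDerivWithin_one]
  have h1 := hu.hasDerivWithinAt (j := 0) (by norm_num) ht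
  rw [iteratedDerivWithin_zero] at h1
  exact (((hu.contDiffAt_nonlin ht).differentiableAt (by norm_num)).hasFDerivAt.comp_hasDerivWithinAt
    t h1).derivWithin (uniqueDiffOn_Icc hu.lt t ht)

theorem contDiffAt_fderiv_nonlin (hu : SmoothSolution L N t₀ T u₀ u) {t : ℝ}
    (ht : t ∈ Icc t₀ T) : ContDiffAt ℝ 2 (fderiv ℝ N) (u t) :=
  (hu.contDiffAt_nonlin ht).fderiv_right (by norm_num)

/-- The Jacobian absorbs `N'(u) u''`; the quadratic term is what makes `J u''` differ from `u⁽³⁾`.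
-/
theorem iteratedDerivWithin_two_comp (hu : SmoothSolution L N t₀ T u₀ u) {t : ℝ}
    (ht : t ∈ Icc t₀ T) :
    iteratedDerivWithin 2 (N ∘ u) (Icc t₀ T) t =
      fderiv ℝ (fderiv ℝ N) (u t) (iteratedDerivWithin 1 u (Icc t₀ T) t)
          (iteratedDerivWithin 1 u (Icc t₀ T) t)
        + fderiv ℝ N (u t) (iteratedDerivWithin 2 u (Icc t₀ T) t) := by
  rw [iteratedDerivWithin_succ, derivWithin_congr
    (fun s hs => hu.iteratedDerivWithin_one_comp hs) (hu.iteratedDerivWithin_one_comp ht)]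
  have h1 := hu.hasDerivWithinAt (j := 0) (by norm_num) ht
  rw [iteratedDerivWithin_zero] at h1
  have h2 := hu.hasDerivWithinAt (j := 1) (by norm_num) ht
  have h3 := ((hu.contDiffAt_fderiv_nonlin ht).differentiableAt
    (by norm_num)).hasFDerivAt.comp_hasDerivWithinAt t h1
  exact (h3.clm_apply h2).derivWithin (uniqueDiffOn_Icc hu.lt t ht)

/-- `Ñ` and `N` differ by a bounded linear map, whose second derivative is zero. -/
theorem secondTerm_eq (hu : SmoothSolution L N t₀ T u₀ u) {t : ℝ} (ht : t ∈ Icc t₀ T) :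
    secondTerm N t₀ T u t =
      fderiv ℝ (fderiv ℝ N) (u t) (iteratedDerivWithin 1 u (Icc t₀ T) t)
        (iteratedDerivWithin 1 u (Icc t₀ T) t) := by
  rw [secondTerm, iteratedFDeriv_two_apply]
  have h1 : fderiv ℝ (remNonlin N (u t)) =ᶠ[𝓝 (u t)]
      fun v => fderiv ℝ N v - fderiv ℝ N (u t) := by
    filter_upwards [(hu.contDiffAt_nonlin ht).eventually (by simp)] with v hv
    exact ((hv.differentiableAt (by norm_num)).hasFDerivAt.sub
      (fderiv ℝ N (u t)).hasFDerivAt).fderiv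
  rw [h1.fderiv_eq, fderiv_sub_const]

/-- The chain `J u' = u''`, `J u'' = u⁽³⁾ - Ñ''(u)(u', u')`, and the bounded vector `J u⁽³⁾`. -/
theorem mem_graph_jacobian (hu : SmoothSolution L N t₀ T u₀ u)
    (hL : IsClosed (L.graph : Set (X × X))) {t : ℝ} (ht : t ∈ Icc t₀ T) :
    (iteratedDerivWithin 1 u (Icc t₀ T) t, iteratedDerivWithin 2 u (Icc t₀ T) t) ∈
        (jacobian L N (u t)).graph ∧
      (iteratedDerivWithin 2 u (Icc t₀ T) t,
        iteratedDerivWithin 3 u (Icc t₀ T) t - secondTerm N t₀ T u t) ∈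
        (jacobian L N (u t)).graph ∧
      (iteratedDerivWithin 3 u (Icc t₀ T) t,
        iteratedDerivWithin 4 u (Icc t₀ T) t - iteratedDerivWithin 3 (N ∘ u) (Icc t₀ T) t
          + fderiv ℝ N (u t) (iteratedDerivWithin 3 u (Icc t₀ T) t)) ∈
        (jacobian L N (u t)).graph := by
  simp only [jacobian, mem_graph_vadd_iff]
  refine ⟨?_, ?_, ?_⟩
  · rw [← hu.iteratedDerivWithin_one_comp ht]
    exact hu.mem_graph hL (j := 1) (by norm_num) t ht
  · rw [hu.secondTerm_eq ht, sub_sub, ← hu.iteratedDerivWithin_two_comp ht]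
    exact hu.mem_graph hL (j := 2) (by norm_num) t ht
  · rw [add_sub_cancel_right]
    exact hu.mem_graph hL (j := 3) le_rfl t ht

theorem continuousOn_fderiv (hu : SmoothSolution L N t₀ T u₀ u) :
    ContinuousOn (fun t => fderiv ℝ N (u t)) (Icc t₀ T) := fun t ht =>
  (hu.contDiffAt_fderiv_nonlin ht).continuousAt.comp_continuousWithinAt
    (hu.contDiffOn.continuousOn t ht)

/-- The vector is `J u⁽³⁾`. Leaving `(N ∘ u)⁽³⁾` unexpanded avoids the third-order chain rule:
continuity on a compact interval is enough. -/
theorem exists_norm_le_jacobian_third (hu : SmoothSolution L N t₀ T u₀ u) :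
    ∃ C : ℝ, ∀ t ∈ Icc t₀ T,
      ‖iteratedDerivWithin 4 u (Icc t₀ T) t - iteratedDerivWithin 3 (N ∘ u) (Icc t₀ T) t
          + fderiv ℝ N (u t) (iteratedDerivWithin 3 u (Icc t₀ T) t)‖ ≤ C := by
  have hI := uniqueDiffOn_Icc hu.lt
  refine isCompact_Icc.exists_bound_of_continuousOn (((hu.contDiffOn.continuousOn_iteratedDerivWithin
    (by norm_num) hI).sub (hu.contDiffOn_comp.continuousOn_iteratedDerivWithin (by norm_num) hI)).add
    (hu.continuousOn_fderiv.clm_apply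
      (hu.contDiffOn.continuousOn_iteratedDerivWithin (by norm_num) hI)))

/-! ### Uniform bounds along the trajectory. -/

/-- The Jacobians along the trajectory generate semigroups that are uniformly bounded on bounded
time intervals. -/
theorem exists_uniform_bound [CompleteSpace X] (hu : SmoothSolution L N t₀ T u₀ u)
    (hL : GeneratesC0Semigroup L) :
    ∃ C ω : ℝ, 0 ≤ C ∧ 0 ≤ ω ∧ ∀ t ∈ Icc t₀ T, GeneratesC0Semigroup (jacobian L N (u t)) ∧
      ∀ r, 0 ≤ r → ‖expSemigroup (jacobian L N (u t)) r‖ ≤ C * Real.exp (ω * r) := by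
  obtain ⟨S, hS, hA⟩ := hL
  obtain ⟨β, hβ⟩ := isCompact_Icc.exists_bound_of_continuousOn hu.continuousOn_fderiv
  obtain ⟨C, ω, hC, hω, h⟩ := hA.exists_vadd hS β
  refine ⟨C, ω, hC, hω, fun t ht => ?_⟩
  obtain ⟨V, hV, hG, hb⟩ := h _ (hβ t ht)
  have hgen : GeneratesC0Semigroup (jacobian L N (u t)) := ⟨V, hV, hG⟩
  refine ⟨hgen, fun r hr => ?_⟩
  obtain ⟨hE, hEG⟩ := hgen.expSemigroup_spec
  rw [hEG.eq_of_nonneg hE hG hV hr]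
  exact hb r hr

/-- The remainder of the third order expansion of `φ_k(τ J) f(u)` is `O(τ³)`, uniformly along the
trajectory. -/
theorem exists_phi_remainder_le [CompleteSpace X] (hu : SmoothSolution L N t₀ T u₀ u)
    (hL : GeneratesC0Semigroup L) {k : ℕ} (hk : 1 ≤ k) (H : ℝ) :
    ∃ C : ℝ, ∀ tn (htn : tn ∈ Icc t₀ T), ∀ τ : ℝ, 0 ≤ τ → τ ≤ H →
      ‖phi k τ (jacobian L N (u tn)) (rhs L N ⟨u tn, hu.mem_domain tn htn⟩)
          - ((1 / (k.factorial : ℝ)) • iteratedDerivWithin 1 u (Icc t₀ T) tn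
            + (τ / ((k + 1).factorial : ℝ)) • iteratedDerivWithin 2 u (Icc t₀ T) tn
            + τ ^ 2 • ((1 / ((k + 2).factorial : ℝ)) • iteratedDerivWithin 3 u (Icc t₀ T) tn
              - phi (k + 2) τ (jacobian L N (u tn)) (secondTerm N t₀ T u tn)))‖
        ≤ C * τ ^ 3 := by
  have hcl : IsClosed (L.graph : Set (X × X)) := by
    obtain ⟨S, hS, hA⟩ := hL
    exact hA.isClosed_graph hS
  obtain ⟨C, ω, hC, hω, h⟩ := hu.exists_uniform_bound hL
  obtain ⟨D, hD⟩ := hu.exists_norm_le_jacobian_third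
  refine ⟨C * Real.exp (ω * H) * D, fun tn htn τ hτ hτH => ?_⟩
  obtain ⟨hgen, hb⟩ := h tn htn
  obtain ⟨h₁, h₂, h₃⟩ := hu.mem_graph_jacobian hcl htn
  -- After the exact expansion only `τ³ φ_{k+3}(τJ) J u⁽³⁾` is left to estimate.
  rw [← hu.iteratedDerivWithin_one_eq htn, hgen.phi_expansion h₁ h₂ h₃ hk hτ,
    add_sub_cancel_left, norm_smul, Real.norm_of_nonneg (by positivity), mul_comm]
  gcongr
  refine (norm_phi_le hτ (C := C * Real.exp (ω * H)) (fun r hr => (hb r hr.1).trans ?_)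
    (k + 3) _).trans ?_
  · have := hr.2.trans hτH
    gcongr
  · gcongr
    exact hD tn htn

end SmoothSolution

end EPIRK

/-! ### The expansions (i) and (ii). -/

theorem mainTheorem4 {X : Type*} [NormedAddCommGroup X] [NormedSpace ℝ X] [CompleteSpace X]
    (L : X →ₗ.[ℝ] X) (N : X → X) (t₀ T : ℝ) (u₀ : X) (u : ℝ → X)
    (hL : EPIRK.GeneratesC0Semigroup L)
    (hu : EPIRK.SmoothSolution L N t₀ T u₀ u) :
    (∀ tn ∈ Set.Icc t₀ T, EPIRK.GeneratesC0Semigroup (EPIRK.jacobian L N (u tn))) ∧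
    (∀ k : ℕ, 1 ≤ k → ∀ H : ℝ, ∃ C : ℝ,
      ∀ tn (htn : tn ∈ Set.Icc t₀ T), ∀ t h : ℝ, 0 ≤ t → 0 ≤ h → t * h ≤ H →
        ‖EPIRK.phi k (t * h) (EPIRK.jacobian L N (u tn))
              (EPIRK.rhs L N ⟨u tn, hu.mem_domain tn htn⟩)
            - ((1 / (k.factorial : ℝ)) • iteratedDerivWithin 1 u (Set.Icc t₀ T) tn
              + (h * (t / ((k + 1).factorial : ℝ))) •
                  iteratedDerivWithin 2 u (Set.Icc t₀ T) tn
              + (t ^ 2 * h ^ 2 * (1 / ((k + 2).factorial : ℝ))) •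
                  (iteratedDerivWithin 3 u (Set.Icc t₀ T) tn
                    - ((k + 2).factorial : ℝ) •
                        EPIRK.phi (k + 2) (t * h) (EPIRK.jacobian L N (u tn))
                          (EPIRK.secondTerm N t₀ T u tn)))‖
          ≤ C * (t ^ 3 * h ^ 3)) ∧
    (∀ (s : ℕ) (p : ℕ → ℝ) (H : ℝ), ∃ C : ℝ,
      ∀ tn (htn : tn ∈ Set.Icc t₀ T), ∀ t : ℝ, 0 ≤ t → t ≤ H →
        ‖EPIRK.psi s p t (EPIRK.jacobian L N (u tn))
              (EPIRK.rhs L N ⟨u tn, hu.mem_domain tn htn⟩)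
            - (EPIRK.bigP1 s p • iteratedDerivWithin 1 u (Set.Icc t₀ T) tn
              + (t * EPIRK.bigP2 s p) • iteratedDerivWithin 2 u (Set.Icc t₀ T) tn
              + t ^ 2 • (EPIRK.bigP3 s p • iteratedDerivWithin 3 u (Set.Icc t₀ T) tn
                  - ∑ k ∈ Finset.Icc 1 s, p k •
                      EPIRK.phi (k + 2) t (EPIRK.jacobian L N (u tn))
                        (EPIRK.secondTerm N t₀ T u tn)))‖
          ≤ C * t ^ 3) := by
  refine ⟨fun tn htn => ?_, fun k hk H => ?_, fun s p H => ?_⟩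
  · obtain ⟨C, ω, -, -, h⟩ := hu.exists_uniform_bound hL
    exact (h tn htn).1
  · obtain ⟨C, hC⟩ := hu.exists_phi_remainder_le hL hk H
    refine ⟨C, fun tn htn t h ht hh hH => ?_⟩
    have hf : ((k + 2).factorial : ℝ) ≠ 0 := by positivity
    rw [← mul_pow t h 3, ← mul_pow t h 2]
    refine le_of_eq_of_le ?_ (hC tn htn (t * h) (mul_nonneg ht hh) hH)
    congr 2
    have e1 : h * (t / ((k + 1).factorial : ℝ)) = t * h / ((k + 1).factorial : ℝ) := by ring
    rw [e1, mul_smul ((t * h) ^ 2), smul_sub (1 / ((k + 2).factorial : ℝ)),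
      smul_smul (1 / ((k + 2).factorial : ℝ)), one_div_mul_cancel hf, one_smul]
  -- With `1 ≤ k` inside the existential, `choose` yields a constant for every `k`; the value at `k
  -- = 0` is never used.
  · have hex : ∀ k, ∃ C : ℝ, 1 ≤ k → ∀ tn (htn : tn ∈ Set.Icc t₀ T), ∀ τ : ℝ, 0 ≤ τ → τ ≤ H →
        ‖EPIRK.phi k τ (EPIRK.jacobian L N (u tn))
              (EPIRK.rhs L N ⟨u tn, hu.mem_domain tn htn⟩)
            - ((1 / (k.factorial : ℝ)) • iteratedDerivWithin 1 u (Set.Icc t₀ T) tn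
              + (τ / ((k + 1).factorial : ℝ)) • iteratedDerivWithin 2 u (Set.Icc t₀ T) tn
              + τ ^ 2 • ((1 / ((k + 2).factorial : ℝ)) •
                  iteratedDerivWithin 3 u (Set.Icc t₀ T) tn
                - EPIRK.phi (k + 2) τ (EPIRK.jacobian L N (u tn))
                    (EPIRK.secondTerm N t₀ T u tn)))‖ ≤ C * τ ^ 3 := by
      intro k
      by_cases hk : 1 ≤ k
      · obtain ⟨C, hC⟩ := hu.exists_phi_remainder_le hL hk H
        exact ⟨C, fun _ => hC⟩
      · exact ⟨0, fun h => absurd h hk⟩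
    choose C hC using hex
    refine ⟨∑ k ∈ Finset.Icc 1 s, |p k| * C k, fun tn htn t ht hH => ?_⟩
    rw [Finset.sum_mul]
    have hsum := norm_sum_le_of_le (Finset.Icc 1 s) (f := fun k => p k • (EPIRK.phi k t
        (EPIRK.jacobian L N (u tn)) (EPIRK.rhs L N ⟨u tn, hu.mem_domain tn htn⟩)
            - ((1 / (k.factorial : ℝ)) • iteratedDerivWithin 1 u (Set.Icc t₀ T) tn
              + (t / ((k + 1).factorial : ℝ)) • iteratedDerivWithin 2 u (Set.Icc t₀ T) tn
              + t ^ 2 • ((1 / ((k + 2).factorial : ℝ)) •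
                  iteratedDerivWithin 3 u (Set.Icc t₀ T) tn
                - EPIRK.phi (k + 2) t (EPIRK.jacobian L N (u tn))
                    (EPIRK.secondTerm N t₀ T u tn)))))
      (n := fun k => |p k| * C k * t ^ 3) (by
        intro k hk
        rw [norm_smul, Real.norm_eq_abs, mul_assoc]
        exact mul_le_mul_of_nonneg_left (hC k (Finset.mem_Icc.1 hk).1 tn htn t ht hH)
          (abs_nonneg _))
    refine le_of_eq_of_le ?_ hsum
    congr 1
    simp only [EPIRK.psi, EPIRK.bigP1, EPIRK.bigP2, EPIRK.bigP3, Finset.mul_sum, Finset.sum_smul,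
      Finset.smul_sum, ← Finset.sum_sub_distrib, ← Finset.sum_add_distrib]
    refine Finset.sum_congr rfl fun k _ => ?_
    module
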